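/- Let $(R,\mathfrak m)$ be a Noetherian local ring of dimension $d\ge 1$, and let $R\subseteq S$ be a ring extension such that $S$ is a finite $R$-module, $S$ is a Cohen–Macaulay local ring, and the $R$-module $S/R$ has finite length. Write $\lambda$ for length as an $R$-module and $\mu_R$ for the minimum number of generators of an $R$-module. For an $\mathfrak m$-primary ideal $I$ of $R$ let $P_I\in\mathbb Q[X]$ be the polynomial with $P_I(n)=\lambda(R/I^{n+1})$ for $n\gg 0$; it has degree $d$, and its Hilbert coefficients $e_i(I)$ are defined by $P_I(X)=\sum_{i=0}^{d}(-1)^i e_i(I)\binom{X+d-i}{d-i}$. A parameter ideal of $R$ is an ideal generated by a system of parameters $x_1,\dots,x_d$, that is, by $d$ elements that generate an $\mathfrak m$-primary ideal. Then $\mu_R(S/R)=\lambda(S/R)$ if and only if $\mathfrak mS\subseteq R$. Suppose that these equivalent conditions hold. Then: (a) if $d\ge 2$, then $e_1(J)=-\mu_R(S/R)=-\lambda(S/R)$ for every parameter ideal $J$ of $R$; (b) $\lambda(R/J)-e_0(J)=(d-1)\,\lambda(S/R)$ for every parameter ideal $J$ of $R$; in particular this difference is independent of $J$; (c) $R$ is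 Buchsbaum, that is, $\big((x_1,\dots,x_{i-1}):x_i\big)=\big((x_1,\dots,x_{i-1}):\mathfrak m\big)$ for every system of parameters $x_1,\dots,x_d$ of $R$ and every $1\le i\le d$. -/

import Mathlib

open Filter IsLocalRing

noncomputable section

namespace LocalCover

/-! ### Hilbert coefficients of a polynomial -/

/-- The polynomials `(X + k).choose k = (X + 1) ⋯ (X + k) / k!`, one in each degree `k`. -/
def binomSeq : Polynomial.Sequence ℚ where
  elems' k := Polynomial.preHilbertPoly ℚ k 0
  degree_eq' k := by
    have h0 : Polynomial.preHilbertPoly ℚ k 0 ≠ 0 := by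
      intro h
      have h1 := Polynomial.coeff_preHilbertPoly_self ℚ k 0
      rw [h, Polynomial.coeff_zero] at h1
      exact inv_ne_zero (by exact_mod_cast Nat.factorial_ne_zero k) h1.symm
    rw [Polynomial.degree_eq_natDegree h0, Polynomial.natDegree_preHilbertPoly]

/-- The basis `(X + k).choose k`, `k = 0, 1, 2, …`, of `ℚ[X]`. -/
def binomBasis : Module.Basis ℕ ℚ (Polynomial ℚ) :=
  binomSeq.basis fun k => (Polynomial.leadingCoeff_ne_zero.mpr (binomSeq.ne_zero k)).isUnit

/-- The `i`-th Hilbert coefficient `e_i(P)`, `0 ≤ i ≤ deg P`: with `d = deg P`,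
`P = ∑_{i=0}^{d} (-1)^i e_i(P) (X + d - i).choose (d - i)`. See `eq_sum_hilbertCoeff`. -/
def hilbertCoeff (P : Polynomial ℚ) (i : ℕ) : ℚ :=
  (-1) ^ i * binomBasis.repr P (P.natDegree - i)

/-- The expansion that characterizes the Hilbert coefficients. -/
theorem eq_sum_hilbertCoeff (P : Polynomial ℚ) :
    P = ∑ i ∈ Finset.range (P.natDegree + 1),
      ((-1) ^ i * hilbertCoeff P i) • Polynomial.preHilbertPoly ℚ (P.natDegree - i) 0 := by
  have hmem : P ∈ Submodule.span ℚ (binomBasis '' Set.Iio (P.natDegree + 1)) := by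
    have hb : (binomBasis : ℕ → Polynomial ℚ) = binomSeq := by
      funext k
      exact Polynomial.Sequence.basis_eq_self _ _ k
    rw [hb, Polynomial.Sequence.span_degreeLT _ (fun k _ =>
      (Polynomial.leadingCoeff_ne_zero.mpr (binomSeq.ne_zero k)).isUnit),
      Polynomial.mem_degreeLT]
    exact lt_of_le_of_lt Polynomial.degree_le_natDegree (by exact_mod_cast Nat.lt_succ_self _)
  have hsupp : (binomBasis.repr P).support ⊆ Finset.range (P.natDegree + 1) := by
    intro k hk
    have := (binomBasis.mem_span_image.mp hmem) hk
    simpa using this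
  have hsum : P = ∑ k ∈ Finset.range (P.natDegree + 1),
      binomBasis.repr P k • Polynomial.preHilbertPoly ℚ k 0 := by
    conv_lhs => rw [← binomBasis.linearCombination_repr P]
    rw [Finsupp.linearCombination_apply, Finsupp.sum_of_support_subset _ hsupp _ (by simp)]
    refine Finset.sum_congr rfl fun k _ => ?_
    congr 1
    exact Polynomial.Sequence.basis_eq_self _ _ k
  conv_lhs => rw [hsum]
  rw [← Finset.sum_range_reflect]
  refine Finset.sum_congr rfl fun i _ => ?_
  rw [hilbertCoeff, ← mul_assoc, ← mul_pow]
  simp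

/-! ### Hilbert polynomial and Hilbert coefficients of an ideal -/

section Ring

variable {R : Type*} [CommRing R]

/-- `P` is the polynomial associated to the function `n ↦ λ(R / I ^ (n + 1))`: for `n ≫ 0`
that length is finite and equal to `P n`. There is at most one such polynomial. -/
def IsHilbertPolynomial (I : Ideal R) (P : Polynomial ℚ) : Prop :=
  ∀ᶠ n : ℕ in atTop, ∃ l : ℕ, Module.length R (R ⧸ I ^ (n + 1)) = l ∧ P.eval (n : ℚ) = l

open Classical in
/-- The polynomial `P_I` associated to `n ↦ λ(R / I ^ (n + 1))` (zero if there is none). -/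
def hilbertPolynomial (I : Ideal R) : Polynomial ℚ :=
  if h : ∃ P : Polynomial ℚ, IsHilbertPolynomial I P then h.choose else 0

/-- The multiplicity `e_0(I)`. -/
def e0 (I : Ideal R) : ℚ := hilbertCoeff (hilbertPolynomial I) 0

/-- The Chern number `e_1(I)`. -/
def e1 (I : Ideal R) : ℚ := hilbertCoeff (hilbertPolynomial I) 1

end Ring

/-! ### Systems of parameters, Cohen–Macaulay and Buchsbaum local rings -/

section LocalRing

variable (R : Type*) [CommRing R] [IsLocalRing R]

/-- `x₁, …, x_k` is a system of parameters of the local ring `R`: `k = dim R` and the ideal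
`(x₁, …, x_k)` is primary to the maximal ideal. -/
def IsSystemOfParameters {k : ℕ} (x : Fin k → R) : Prop :=
  ringKrullDim R = k ∧ (Ideal.span (Set.range x)).radical = maximalIdeal R

/-- A parameter ideal is an ideal generated by a system of parameters. -/
def IsParameterIdeal (J : Ideal R) : Prop :=
  ∃ (k : ℕ) (x : Fin k → R), IsSystemOfParameters R x ∧ J = Ideal.span (Set.range x)

/-- `R` is Cohen–Macaulay: its maximal ideal contains a regular sequence of length `dim R`. -/
def IsCohenMacaulayLocal : Prop :=
  ∃ rs : List R, (∀ r ∈ rs, r ∈ maximalIdeal R) ∧ RingTheory.Sequence.IsRegular R rs ∧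
    ringKrullDim R = rs.length

/-- `R` is Buchsbaum: every system of parameters `x₁, …, x_k` is a weak sequence, i.e.
`((x₁, …, x_{i-1}) : x_i) = ((x₁, …, x_{i-1}) : 𝔪)` for `i = 1, …, k`. -/
def IsBuchsbaum : Prop :=
  ∀ (k : ℕ) (x : Fin k → R), IsSystemOfParameters R x → ∀ (i : Fin k) (y : R),
    x i * y ∈ Ideal.span (x '' Set.Iio i) ↔
      ∀ a ∈ maximalIdeal R, a * y ∈ Ideal.span (x '' Set.Iio i)

end LocalRing

/-! ### The module `S / R` of an extension -/

section Cover

variable (R S : Type*) [CommRing R] [CommRing S] [Algebra R S]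

/-- The `R`-module `S / R`. -/
abbrev CoverQuotient : Type _ := S ⧸ LinearMap.range (Algebra.linearMap R S)

/-- The condition `𝔪 S ⊆ R`. -/
def MaxIdealSubset [IsLocalRing R] : Prop :=
  ((maximalIdeal R).map (algebraMap R S) : Set S) ⊆ Set.range (algebraMap R S)

end Cover

/-- `μ_R(M)`, the minimum number of generators of a finitely generated `R`-module `M`. -/
def minGen (R M : Type*) [CommRing R] [AddCommGroup M] [Module R M] : ℕ :=
  (⊤ : Submodule R M).spanFinrank

/-- `λ(M)` as a natural number, for an `R`-module `M` of finite length. -/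
def len (R M : Type*) [CommRing R] [AddCommGroup M] [Module R M] : ℕ :=
  (Module.length R M).toNat

end LocalCover

end

open LocalCover

/-! Write `c = λ(S/R)`. By Nakayama `μ(S/R)` is the length of `S/R` modulo `𝔪(S/R)`, so it equals
`c` exactly when `𝔪` kills `S/R`. Assume `𝔪S ⊆ R` and let `J` be a parameter ideal. Since `S` is
Cohen–Macaulay and finite over `R`, the generators of `J` form an `S`-regular sequence
(`isRegularUpTo_of_isCohenMacaulayLocal`). Because `JS ⊆ R ⊆ S`, the layer `JⁿS/JⁿR` then has the
length of `(n + d - 1).choose n` copies of `S/R` (`relLength_pow_smul`). Computing `λ(S/Jⁿ⁺¹R)`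
through `R` and through `Jⁿ⁺¹S` gives, with `e = λ(S/JS)`, `c + λ(R/Jⁿ⁺¹) = e (n + d).choose d + c
∑_{i<d} (n + i).choose i` for every `n`. Hence `e_0 = e`, `e_1 = -c` if `d ≥ 2`, and `n = 0` gives
(b). For (c), `x_i y ∈ (x_1, …, x_{i-1})R` forces `y ∈ (x_1, …, x_{i-1})S`, and multiplying by `a ∈
𝔪` returns to `(x_1, …, x_{i-1})R` because `aS ⊆ R`. -/

open RingTheory.Sequence Submodule
open scoped Pointwise

universe u v

/-! ### Depth without Ext: parameters on a module of large depth are regular. -/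

section Depth

variable {A : Type u} [CommRing A] [IsLocalRing A] [IsNoetherianRing A]

/-- If `a, b` is a weakly regular sequence on `M` in the maximal ideal and `x` is `M`-regular, then
some element of the maximal ideal is regular on both `M / aM` and `M / xM`. -/
lemma exists_mem_maximalIdeal_isSMulRegular_quotSMulTop {M : Type v} [AddCommGroup M] [Module A M]
    [Module.Finite A M] {a b x : A} (ha : a ∈ maximalIdeal A) (hb : b ∈ maximalIdeal A)
    (hab : IsWeaklyRegular M [a, b]) (hx : IsSMulRegular M x) :
    ∃ c ∈ maximalIdeal A, IsSMulRegular (QuotSMulTop a M) c ∧ IsSMulRegular (QuotSMulTop x M) c := by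
  rw [isWeaklyRegular_cons_iff, isWeaklyRegular_singleton_iff] at hab
  obtain ⟨hra, hrb⟩ := hab
  have hmem : ∀ {r : A} {z : M}, z ∈ (r • ⊤ : Submodule A M) ↔ ∃ w, r • w = z := by
    intro r z
    simp [Submodule.mem_smul_pointwise_iff_exists]
  -- A single `c` regular on the product serves both factors; it exists once no nonzero element of
  -- the product is killed by the maximal ideal.
  have hsub : Subsingleton ((A ⧸ maximalIdeal A) →ₗ[A] (QuotSMulTop a M × QuotSMulTop x M)) := by
    refine subsingleton_of_forall_eq 0 fun f => ?_
    have hkill : ∀ r ∈ maximalIdeal A, r • f 1 = 0 := by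
      intro r hr
      rw [← map_smul, Algebra.smul_def, mul_one]
      have : algebraMap A (A ⧸ maximalIdeal A) r = 0 := Ideal.Quotient.eq_zero_iff_mem.mpr hr
      rw [this, map_zero]
    have h1 : (f 1).1 = 0 := by
      have := congrArg Prod.fst (hkill b hb)
      exact hrb.right_eq_zero_of_smul this
    have h2 : (f 1).2 = 0 := by
      obtain ⟨z, hz⟩ := Submodule.mkQ_surjective _ (f 1).2
      have hz' : ∀ r ∈ maximalIdeal A, ∃ w, x • w = r • z := by
        intro r hr
        have := congrArg Prod.snd (hkill r hr)
        rw [Prod.smul_snd, ← hz, ← map_smul, Submodule.mkQ_apply, Prod.snd_zero,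
          Submodule.Quotient.mk_eq_zero, hmem] at this
        exact this
      obtain ⟨w, hw⟩ := hz' a ha
      obtain ⟨w', hw'⟩ := hz' b hb
      -- From `x w = a z` and `x w' = b z`, cancelling `x` gives `b w = a w'`; then `w ∈ aM` since
      -- `b` is regular on `M/aM`, and cancelling `a` gives `z ∈ xM`.
      have hbw : b • w = a • w' := hx <| by
        change x • b • w = x • a • w'
        rw [smul_comm x b, hw, smul_comm x a, hw', smul_comm]
      have hwa : w ∈ (a • ⊤ : Submodule A M) :=
        mem_of_isSMulRegular_quotient_of_smul_mem hrb (hmem.mpr ⟨w', hbw.symm⟩)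
      obtain ⟨w'', rfl⟩ := hmem.mp hwa
      have : x • w'' = z := hra <| by
        change a • x • w'' = a • z
        rw [← hw, smul_comm]
      rw [← hz, Submodule.mkQ_apply, Submodule.Quotient.mk_eq_zero, hmem]
      exact ⟨w'', this⟩
    ext1
    ext1
    exact Prod.ext h1 h2
  obtain ⟨c, hc, hreg⟩ := IsSMulRegular.subsingleton_linearMap_iff.mp hsub
  rw [Ideal.annihilator_quotient] at hc
  refine ⟨c, hc, fun u w huw => ?_, fun u w huw => ?_⟩
  · have := @hreg (u, 0) (w, 0) (Prod.ext huw rfl)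
    exact congrArg Prod.fst this
  · have := @hreg (0, u) (0, w) (Prod.ext rfl huw)
    exact congrArg Prod.snd this

/-- Dividing out a regular element lowers the depth by at most one. -/
lemma exists_isWeaklyRegular_cons (n : ℕ) : ∀ {M : Type v} [AddCommGroup M] [Module A M]
    [Module.Finite A M] {x : A} {rs : List A}, x ∈ maximalIdeal A → IsSMulRegular M x →
    (∀ r ∈ rs, r ∈ maximalIdeal A) → IsWeaklyRegular M rs → rs.length = n + 1 →
    ∃ rs' : List A, (∀ r ∈ rs', r ∈ maximalIdeal A) ∧ rs'.length = n ∧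
      IsWeaklyRegular M (x :: rs') := by
  induction n with
  | zero =>
    intro M _ _ _ x rs hx hxM _ _ _
    exact ⟨[], by simp, rfl, (isWeaklyRegular_singleton_iff M x).mpr hxM⟩
  | succ n ih =>
    intro M _ _ _ x rs hx hxM hrs hreg hlen
    obtain ⟨a, b, t, rfl⟩ : ∃ a b t, rs = a :: b :: t := by
      match rs, hlen with
      | a :: b :: t, _ => exact ⟨a, b, t, rfl⟩
    have ha : a ∈ maximalIdeal A := hrs a (by simp)
    have hb : b ∈ maximalIdeal A := hrs b (by simp)
    have hab : IsWeaklyRegular M [a, b] :=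
      ((isWeaklyRegular_append_iff M [a, b] t).mp hreg).1
    obtain ⟨c, hc, hca, hcx⟩ := exists_mem_maximalIdeal_isSMulRegular_quotSMulTop ha hb hab hxM
    rw [isWeaklyRegular_cons_iff] at hreg
    -- Since `c` is compatible with both `a` and `x`, the exchange goes in two stages: `c` is put
    -- into a sequence starting with `a`, then, over `M/cM`, `x` into one starting with `a`.
    -- Permutability of regular sequences in the maximal ideal moves `c` to the front and finally
    -- `x`.
    obtain ⟨t', ht', hlen', hct'⟩ := ih hc hca (fun r hr => hrs r (by simp_all)) hreg.2
      (by simpa using hlen)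
    have h1 : IsWeaklyRegular M (c :: a :: t') :=
      isWeaklyRegular_of_perm_of_subset_maximalIdeal (rs := a :: c :: t') (.cons hreg.1 hct')
        (List.Perm.swap _ _ _) (by simp_all)
    have h2 : IsWeaklyRegular M [c, x] :=
      isWeaklyRegular_of_perm_of_subset_maximalIdeal (rs := [x, c])
        (.cons hxM ((isWeaklyRegular_singleton_iff _ c).mpr hcx))
        (List.Perm.swap _ _ _) (by simp_all)
    rw [isWeaklyRegular_cons_iff] at h1 h2
    rw [isWeaklyRegular_singleton_iff] at h2
    obtain ⟨t'', ht'', hlen'', hxt''⟩ := ih hx h2.2 (by simp_all) h1.2 (by simpa using hlen')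
    exact ⟨c :: t'', by simp_all, by simpa using hlen'',
      isWeaklyRegular_of_perm_of_subset_maximalIdeal (rs := c :: x :: t'') (.cons h1.1 hxt'')
        (List.Perm.swap _ _ _) (by simp_all)⟩

/-- The length of a regular sequence on `M` is at most `dim A / p` for each associated prime `p`
of `M`. -/
lemma length_le_ringKrullDim_quotient_of_isAssociatedPrime (rs : List A) :
    ∀ {M : Type v} [AddCommGroup M] [Module A M] [Module.Finite A M] {p : Ideal A},
    (∀ r ∈ rs, r ∈ maximalIdeal A) → IsWeaklyRegular M rs → IsAssociatedPrime p M →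
    (rs.length : WithBot ℕ∞) ≤ ringKrullDim (A ⧸ p) := by
  induction rs with
  | nil =>
    intro M _ _ _ p _ _ hp
    have := hp.isPrime
    exact ringKrullDim_nonneg_of_nontrivial
  | cons x rs ih =>
    intro M _ _ _ p hrs hreg hp
    rw [isWeaklyRegular_cons_iff] at hreg
    have hpp := hp.isPrime
    obtain ⟨z, hz⟩ := (isAssociatedPrime_iff.mp hp).2
    have hmemp : ∀ r, r ∈ p ↔ r • z = 0 := fun r => by
      conv_lhs => rw [hz]
      simp [Submodule.mem_colon_singleton]
    have hz0 : z ≠ 0 := by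
      rintro rfl
      exact hpp.ne_top (Ideal.eq_top_iff_one _ |>.mpr ((hmemp 1).mpr (by simp)))
    have hxp : x ∉ p := fun h => hz0 (hreg.1.right_eq_zero_of_smul ((hmemp x).mp h))
    let N : Submodule A M := Submodule.torsionBySet A M p
    have hN : ∀ w, w ∈ N ↔ ∀ r ∈ p, r • w = 0 := fun w => by
      simp [N, Submodule.mem_torsionBySet_iff]
    -- If `N ⊆ xM`, regularity of `x` would give `N = xN`, so `N = 0` by Nakayama. The class of `w`
    -- in `M/xM` is killed by `p` and by `x`, which yields an associated prime `q` strictly above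
    -- `p`.
    obtain ⟨w, hwN, hw⟩ : ∃ w ∈ N, w ∉ (x • ⊤ : Submodule A M) := by
      by_contra! hcon
      have hle : N ≤ maximalIdeal A • N := by
        intro w hw
        obtain ⟨w', -, rfl⟩ := Submodule.mem_smul_pointwise_iff_exists _ _ _ |>.mp (hcon w hw)
        refine Submodule.smul_mem_smul (hrs x (by simp)) ((hN w').mpr fun r hr => ?_)
        refine hreg.1.right_eq_zero_of_smul ?_
        rw [smul_comm]
        exact (hN _).mp hw r hr
      have hbot := Submodule.eq_bot_of_le_smul_of_le_jacobson_bot (maximalIdeal A) N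
        (IsNoetherian.noetherian N) hle (maximalIdeal_le_jacobson _)
      have : z ∈ N := (hN z).mpr fun r hr => (hmemp r).mp hr
      rw [hbot, Submodule.mem_bot] at this
      exact hz0 this
    obtain ⟨q, hq, hle⟩ := exists_le_isAssociatedPrime_of_isNoetherianRing A
      (Submodule.Quotient.mk w : QuotSMulTop x M)
      (by rwa [ne_eq, Submodule.Quotient.mk_eq_zero])
    have hmemq : ∀ r, r • w ∈ (x • ⊤ : Submodule A M) → r ∈ q := fun r hr => hle <| by
      rw [Submodule.mem_colon_singleton, ← Submodule.Quotient.mk_smul, Submodule.mem_bot,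
        Submodule.Quotient.mk_eq_zero]
      exact hr
    have hpq : p ≤ q := fun r hr => hmemq r <| by
      rw [(hN w).mp hwN r hr]
      exact zero_mem _
    have hxq : x ∈ q := hmemq x (Submodule.smul_mem_pointwise_smul _ _ _ Submodule.mem_top)
    have hstep := ringKrullDim_succ_le_of_surjective (Ideal.Quotient.factor hpq)
      (Ideal.Quotient.factor_surjective hpq) (r := Ideal.Quotient.mk p x)
      (mem_nonZeroDivisors_of_ne_zero (by rwa [ne_eq, Ideal.Quotient.eq_zero_iff_mem]))
      (by rw [Ideal.Quotient.factor_mk, Ideal.Quotient.eq_zero_iff_mem]; exact hxq)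
    refine le_trans ?_ hstep
    push_cast [List.length_cons]
    gcongr
    exact ih (fun r hr => hrs r (by simp [hr])) hreg.2 hq

/-- If a prime `p` together with `ys` generates an ideal primary to the maximal ideal, then
`dim A / p` is at most the length of `ys`. -/
lemma ringKrullDim_quotient_le_length (p : Ideal A) [hp : p.IsPrime] (ys : List A)
    (hrad : maximalIdeal A ≤ (p ⊔ Ideal.ofList ys).radical)
    (hys : ∀ y ∈ ys, y ∈ maximalIdeal A) :
    ringKrullDim (A ⧸ p) ≤ ys.length := by
  classical
  have : IsLocalRing (A ⧸ p) := .of_surjective' (Ideal.Quotient.mk p) Ideal.Quotient.mk_surjective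
  have hmax : (maximalIdeal (A ⧸ p)).comap (Ideal.Quotient.mk p) = maximalIdeal A :=
    ((local_hom_TFAE (Ideal.Quotient.mk p)).out 0 4).mp
      (IsLocalHom.of_surjective _ Ideal.Quotient.mk_surjective)
  rw [← maximalIdeal_height_eq_ringKrullDim]
  have hmin : maximalIdeal (A ⧸ p) ∈
      (Ideal.span ((ys.toFinset.image (Ideal.Quotient.mk p) : Finset (A ⧸ p)) :
        Set (A ⧸ p))).minimalPrimes := by
    refine ⟨⟨inferInstance, ?_⟩, fun q ⟨hq, hle⟩ _ => ?_⟩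
    · rw [Ideal.span_le]
      intro z hz
      simp only [Finset.coe_image, Set.mem_image, SetLike.mem_coe, List.mem_toFinset] at hz
      obtain ⟨y, hy, rfl⟩ := hz
      rw [SetLike.mem_coe, ← Ideal.mem_comap, hmax]
      exact hys y hy
    · have hqm : maximalIdeal A ≤ q.comap (Ideal.Quotient.mk p) := by
        refine hrad.trans ?_
        rw [Ideal.IsPrime.radical_le_iff inferInstance, sup_le_iff]
        constructor
        · intro r hr
          rw [Ideal.mem_comap, Ideal.Quotient.eq_zero_iff_mem.mpr hr]
          exact zero_mem _
        · refine Ideal.span_le.mpr fun y hy => hle (Ideal.subset_span ?_)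
          simp only [Finset.coe_image, Set.mem_image, SetLike.mem_coe, List.mem_toFinset]
          exact ⟨y, hy, rfl⟩
      intro z hz
      obtain ⟨r, rfl⟩ := Ideal.Quotient.mk_surjective z
      exact hqm (hmax ▸ hz)
  have h1 := Ideal.height_le_card_of_mem_minimalPrimes_span_finset hmin
  have h2 : (ys.toFinset.image (Ideal.Quotient.mk p)).card ≤ ys.length :=
    Finset.card_image_le.trans (List.toFinset_card_le ys)
  exact_mod_cast h1.trans (by exact_mod_cast h2)

/-- If `M` has a regular sequence of length `n` and `y₁, …, y_k`, `k ≤ n`, are elements such that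
`M / (y₁, …, y_k) M` is supported at the maximal ideal only, then `y₁, …, y_k` is weakly regular
on `M`. -/
theorem isWeaklyRegular_of_maximalIdeal_le_radical (ys : List A) : ∀ {M : Type v} [AddCommGroup M]
    [Module A M] [Module.Finite A M] {rs : List A}, (∀ r ∈ rs, r ∈ maximalIdeal A) →
    IsWeaklyRegular M rs → ys.length ≤ rs.length → (∀ y ∈ ys, y ∈ maximalIdeal A) →
    maximalIdeal A ≤ (Module.annihilator A M ⊔ Ideal.ofList ys).radical →
    IsWeaklyRegular M ys := by
  induction ys with
  | nil => intros; exact .nil _ _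
  | cons y ys ih =>
    intro M _ _ _ rs hrs hreg hlen hys hrad
    -- Otherwise `y` lies in an associated prime `p`, and `dim A/p` is at least the length of `rs`
    -- but at most that of `ys`, which is smaller.
    have hy : IsSMulRegular M y := by
      by_contra hy
      have : y ∈ ⋃ p ∈ associatedPrimes A M, (p : Set A) := by
        rw [biUnion_associatedPrimes_eq_compl_regular]
        exact hy
      simp only [Set.mem_iUnion, SetLike.mem_coe] at this
      obtain ⟨p, hp, hyp⟩ := this
      have := hp.isPrime
      have h1 := length_le_ringKrullDim_quotient_of_isAssociatedPrime rs hrs hreg hp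
      have h2 : ringKrullDim (A ⧸ p) ≤ ys.length := by
        refine ringKrullDim_quotient_le_length p ys (hrad.trans (Ideal.radical_mono ?_))
          (fun z hz => hys z (by simp [hz]))
        rw [Ideal.ofList_cons, ← sup_assoc]
        refine sup_le_sup_right (sup_le ?_ ?_) _
        · have := hp.annihilator_le
          rwa [Submodule.annihilator_top] at this
        · rwa [Ideal.span_singleton_le_iff_mem]
      have h3 := h1.trans h2
      have h4 : rs.length ≤ ys.length := by exact_mod_cast h3
      simp only [List.length_cons] at hlen
      omega
    obtain ⟨k, hk⟩ : ∃ k, rs.length = k + 1 :=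
      ⟨rs.length - 1, by simp only [List.length_cons] at hlen; omega⟩
    obtain ⟨rs', hrs', hlen', hreg'⟩ :=
      exists_isWeaklyRegular_cons k (hys y (by simp)) hy hrs hreg hk
    rw [isWeaklyRegular_cons_iff] at hreg'
    refine .cons hy (ih hrs' hreg'.2 (by simp only [List.length_cons] at hlen; omega)
      (fun z hz => hys z (by simp [hz])) (hrad.trans (Ideal.radical_mono ?_)))
    rw [Ideal.ofList_cons, ← sup_assoc]
    refine sup_le_sup_right (sup_le ?_ ?_) _
    · exact LinearMap.annihilator_le_of_surjective (Submodule.mkQ _) (Submodule.mkQ_surjective _)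
    · rw [Ideal.span_singleton_le_iff_mem]
      exact QuotSMulTop.mem_annihilator M y

end Depth

/-- An injective integral extension does not lower the Krull dimension. -/
lemma ringKrullDim_le_of_isIntegral {R S : Type*} [CommRing R] [CommRing S] [Algebra R S]
    [Algebra.IsIntegral R S] (hinj : Function.Injective (algebraMap R S)) :
    ringKrullDim R ≤ ringKrullDim S := by
  refine iSup_le fun l => ?_
  have : FaithfulSMul R S := (faithfulSMul_iff_algebraMap_injective R S).mpr hinj
  obtain ⟨P, hP⟩ := Algebra.IsIntegral.comap_surjective R S l.head
  have : P.asIdeal.LiesOver l.head.asIdeal := ⟨(congrArg PrimeSpectrum.asIdeal hP).symm⟩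
  obtain ⟨L, hL, -⟩ := Ideal.exists_ltSeries_of_hasGoingUp l P.asIdeal
  rw [← hL]
  exact Order.LTSeries.length_le_krullDim L

/-! ### Lengths of subquotients. -/

section RelLength

variable {A M M' : Type*} [CommRing A] [AddCommGroup M] [Module A M] [AddCommGroup M'] [Module A M']

/-- The length of `U / (U ∩ V)` for submodules `U` and `V` of a module. -/
noncomputable def relLength (U V : Submodule A M) : ℕ∞ := Module.length A (U.map V.mkQ)

lemma relLength_top_left (V : Submodule A M) : relLength ⊤ V = Module.length A (M ⧸ V) := by
  rw [relLength, Submodule.map_top, Submodule.range_mkQ, Module.length_top]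

lemma relLength_self_left_of_le {U V : Submodule A M} (h : U ≤ V) : relLength U V = 0 := by
  have : U.map V.mkQ = ⊥ := by
    rwa [← le_bot_iff, Submodule.map_le_iff_le_comap, Submodule.comap_bot, Submodule.ker_mkQ]
  rw [relLength, this]
  simp

lemma relLength_sup_left (U V : Submodule A M) : relLength (U ⊔ V) V = relLength U V := by
  rw [relLength, relLength, Submodule.map_sup, Submodule.mkQ_map_self, sup_bot_eq]

/-- Both sides are the length of `U` modulo the same kernel, so `f` need not be injective. -/
lemma relLength_map (f : M →ₗ[A] M') (U V : Submodule A M) (D : Submodule A M')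
    (h : ∀ u ∈ U, f u ∈ D ↔ u ∈ V) : relLength (U.map f) D = relLength U V := by
  let g₁ : U →ₗ[A] M ⧸ V := V.mkQ ∘ₗ U.subtype
  let g₂ : U →ₗ[A] M' ⧸ D := D.mkQ ∘ₗ f ∘ₗ U.subtype
  have h₁ : LinearMap.range g₁ = U.map V.mkQ := by
    rw [LinearMap.range_comp, Submodule.range_subtype]
  have h₂ : LinearMap.range g₂ = (U.map f).map D.mkQ := by
    rw [LinearMap.range_comp, LinearMap.range_comp, Submodule.range_subtype]
  have hker : LinearMap.ker g₂ = LinearMap.ker g₁ := by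
    ext u
    simpa [g₁, g₂] using h u u.2
  rw [relLength, relLength, ← h₁, ← h₂, ← g₁.quotKerEquivRange.length_eq,
    ← g₂.quotKerEquivRange.length_eq, hker]

lemma relLength_eq_add {U V W : Submodule A M} (hWV : W ≤ V) (hVU : V ≤ U) :
    relLength U W = relLength U V + relLength V W := by
  let f : V.map W.mkQ →ₗ[A] U.map W.mkQ := Submodule.inclusion (Submodule.map_mono hVU)
  let p : M ⧸ W →ₗ[A] M ⧸ V := Submodule.factor hWV
  have hp : ∀ u, p (W.mkQ u) = V.mkQ u := fun u => rfl
  have hmem : ∀ z ∈ U.map W.mkQ, p z ∈ U.map V.mkQ := by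
    rintro _ ⟨u, hu, rfl⟩
    exact ⟨u, hu, rfl⟩
  let g : U.map W.mkQ →ₗ[A] U.map V.mkQ := p.restrict hmem
  rw [relLength, relLength, relLength, add_comm]
  refine Module.length_eq_add_of_exact f g (Submodule.inclusion_injective _) ?_ ?_
  · rintro ⟨_, u, hu, rfl⟩
    exact ⟨⟨W.mkQ u, u, hu, rfl⟩, rfl⟩
  · rintro ⟨_, u, hu, rfl⟩
    have h1 : g ⟨W.mkQ u, u, hu, rfl⟩ = 0 ↔ u ∈ V := by
      rw [← Submodule.Quotient.mk_eq_zero V, ← Submodule.coe_eq_zero]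
      rfl
    refine h1.trans ⟨fun huV => ⟨⟨W.mkQ u, u, huV, rfl⟩, rfl⟩, ?_⟩
    rintro ⟨⟨_, v, hv, rfl⟩, hvu⟩
    have h2 : W.mkQ v = W.mkQ u := congrArg Subtype.val hvu
    rw [Submodule.mkQ_apply, Submodule.mkQ_apply, Submodule.Quotient.eq] at h2
    have h3 := V.sub_mem hv (hWV h2)
    rwa [sub_sub_cancel] at h3

end RelLength

/-! ### Power filtrations of ideals generated by regular sequences. -/

section Filtration

variable {A M : Type*} [CommRing A] [AddCommGroup M] [Module A M]

/-- With `K` principal this is the recursion behind the double induction on the number of generators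
and the exponent. -/
lemma Ideal.sup_pow_succ (I K : Ideal A) (n : ℕ) :
    (I ⊔ K) ^ (n + 1) = I ^ (n + 1) ⊔ K * (I ⊔ K) ^ n := by
  induction n with
  | zero => simp
  | succ n ih =>
    have h1 : I * (I ⊔ K) ^ (n + 1) ≤ I ^ (n + 1 + 1) ⊔ K * (I ⊔ K) ^ (n + 1) := by
      rw [ih, Ideal.mul_sup, ← pow_succ', ← ih, mul_left_comm]
      refine sup_le_sup_left (Ideal.mul_mono_right ?_) _
      rw [pow_succ']
      exact Ideal.mul_mono_left le_sup_left
    refine le_antisymm ?_ (sup_le (Ideal.pow_right_mono le_sup_left _) ?_)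
    · rw [pow_succ' (I ⊔ K) (n + 1), Ideal.sup_mul]
      exact sup_le h1 le_sup_right
    · rw [pow_succ' (I ⊔ K) (n + 1)]
      exact Ideal.mul_mono_left le_sup_right

variable (x : ℕ → A)

/-- The ideal generated by the first `k` terms of a sequence. -/
def initialIdeal (k : ℕ) : Ideal A := Ideal.span (x '' Set.Iio k)

lemma initialIdeal_zero : initialIdeal x 0 = ⊥ := by simp [initialIdeal]

lemma initialIdeal_succ (k : ℕ) :
    initialIdeal x (k + 1) = initialIdeal x k ⊔ Ideal.span {x k} := by
  have : Set.Iio (k + 1) = Set.Iio k ∪ {k} := by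
    ext i
    simp only [Set.mem_Iio, Set.union_singleton, Set.mem_insert_iff]
    omega
  rw [initialIdeal, this, Set.image_union, Set.image_singleton, Ideal.span_union, initialIdeal]

lemma initialIdeal_succ_pow_smul (k n : ℕ) (N : Submodule A M) :
    initialIdeal x (k + 1) ^ (n + 1) • N =
      initialIdeal x k ^ (n + 1) • N ⊔ x k • (initialIdeal x (k + 1) ^ n • N) := by
  rw [initialIdeal_succ, Ideal.sup_pow_succ, Submodule.sup_smul, mul_smul,
    Submodule.ideal_span_singleton_smul]

lemma initialIdeal_le_succ (k : ℕ) : initialIdeal x k ≤ initialIdeal x (k + 1) := by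
  rw [initialIdeal_succ]
  exact le_sup_left

lemma mem_initialIdeal_succ (k : ℕ) : x k ∈ initialIdeal x (k + 1) :=
  Ideal.subset_span ⟨k, Nat.lt_succ_self k, rfl⟩

lemma pow_succ_smul_top_le_pow_smul {I : Ideal A} {N : Submodule A M}
    (hN : I • (⊤ : Submodule A M) ≤ N) (n : ℕ) : I ^ (n + 1) • (⊤ : Submodule A M) ≤ I ^ n • N := by
  rw [pow_succ, mul_smul]
  exact Submodule.smul_mono le_rfl hN

lemma smul_mem_smul_of_forall_smul_mem {I : Ideal A} {N : Submodule A M} {y : A}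
    (hy : ∀ m : M, y • m ∈ N) {m : M} (hm : m ∈ I • (⊤ : Submodule A M)) : y • m ∈ I • N := by
  have h1 : y • m ∈ (I • (⊤ : Submodule A M)).map (DistribSMul.toLinearMap A M y) := ⟨m, hm, rfl⟩
  rw [Submodule.map_smul''] at h1
  refine Submodule.smul_mono le_rfl ?_ h1
  rintro _ ⟨z, -, rfl⟩
  exact hy z

/-- If `y` is regular on all layers `Iⁿ M / Iⁿ⁺¹ M`, then `y` is regular on
`M / Iⁿ M`. -/
lemma mem_pow_smul_top_of_smul_mem {I : Ideal A} {y : A}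
    (hlayer : ∀ n, ∀ m ∈ I ^ n • (⊤ : Submodule A M), y • m ∈ I ^ n • I • (⊤ : Submodule A M) →
      m ∈ I ^ n • I • (⊤ : Submodule A M)) (n : ℕ) :
    ∀ m : M, y • m ∈ I ^ n • (⊤ : Submodule A M) → m ∈ I ^ n • (⊤ : Submodule A M) := by
  induction n with
  | zero => simp
  | succ n ih =>
    intro m hm
    rw [pow_succ, mul_smul] at hm ⊢
    refine hlayer n m (ih m ?_) hm
    rw [← mul_smul, ← pow_succ] at hm
    exact Submodule.smul_mono_left (Ideal.pow_le_pow_right n.le_succ) hm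

/-- The terms of `x` up to `d` form a weakly regular sequence on `M`. -/
def IsRegularUpTo (M : Type*) [AddCommGroup M] [Module A M] (d : ℕ) : Prop :=
  ∀ i < d, ∀ m : M, x i • m ∈ initialIdeal x i • (⊤ : Submodule A M) →
    m ∈ initialIdeal x i • (⊤ : Submodule A M)

variable {x}

lemma IsRegularUpTo.mono {d k : ℕ} (h : IsRegularUpTo x M d) (hk : k ≤ d) : IsRegularUpTo x M k :=
  fun i hi => h i (hi.trans_le hk)

/-- If `y` is regular on `M / N`, where `N ⊇ J M` and `J` is generated by an `M`-regular sequence,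
then `y` is regular on all `Jⁿ M / Jⁿ N`. -/
lemma mem_pow_smul_of_smul_mem (k : ℕ) : IsRegularUpTo x M k → ∀ (N : Submodule A M) (y : A),
    initialIdeal x k • (⊤ : Submodule A M) ≤ N → (∀ m : M, y • m ∈ N → m ∈ N) →
    ∀ n, ∀ m ∈ initialIdeal x k ^ n • (⊤ : Submodule A M),
      y • m ∈ initialIdeal x k ^ n • N → m ∈ initialIdeal x k ^ n • N := by
  induction k with
  | zero =>
    intro _ N y _ hy n m hm hym
    cases n with
    | zero => simpa using hy m (by simpa using hym)
    | succ n =>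
      rw [initialIdeal_zero, ← Ideal.zero_eq_bot, zero_pow n.succ_ne_zero, Ideal.zero_eq_bot,
        Submodule.bot_smul, Submodule.mem_bot] at hm
      rw [hm]
      exact zero_mem _
  | succ k ih =>
    intro hreg N y hN hy n
    have hregk := hreg.mono k.le_succ
    -- The induction hypothesis is used for two pairs: `x k` with `initialIdeal x k • ⊤` here, and
    -- the given `y` with `N` below.
    have hcolon := mem_pow_smul_top_of_smul_mem
      (ih hregk (initialIdeal x k • ⊤) (x k) le_rfl (hreg k k.lt_succ_self))
    have hNk : initialIdeal x k • (⊤ : Submodule A M) ≤ N :=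
      (Submodule.smul_mono_left (initialIdeal_le_succ x k)).trans hN
    induction n with
    | zero =>
      intro m _ hym
      simpa using hy m (by simpa using hym)
    | succ n ihn =>
      intro m hm hym
      rw [initialIdeal_succ_pow_smul] at hm hym ⊢
      obtain ⟨u, hu, _, ⟨v, hv, rfl⟩, rfl⟩ := Submodule.mem_sup.mp hm
      obtain ⟨u', hu', _, ⟨v', hv', rfl⟩, heq⟩ := Submodule.mem_sup.mp hym
      change u' + x k • v' = y • (u + x k • v) at heq
      have hw : x k • (v' - y • v) = y • u - u' := by
        rw [smul_sub, sub_eq_sub_iff_add_eq_add, add_comm, heq, smul_add, smul_comm y]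
      have hu'' : u' ∈ initialIdeal x k ^ (n + 1) • (⊤ : Submodule A M) :=
        Submodule.smul_mono le_rfl le_top hu'
      have hwmem : v' - y • v ∈ initialIdeal x k ^ (n + 1) • (⊤ : Submodule A M) := by
        refine hcolon (n + 1) _ ?_
        rw [hw]
        exact sub_mem (Submodule.smul_mem _ _ hu) hu''
      refine Submodule.mem_sup.mpr ⟨u, ih hregk N y hNk hy (n + 1) u hu ?_, x k • v,
        Submodule.smul_mem_pointwise_smul _ _ _ (ihn v hv ?_), rfl⟩
      · have h1 : x k • (v' - y • v) ∈ initialIdeal x k ^ (n + 1) • N := by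
          exact smul_mem_smul_of_forall_smul_mem (fun z =>
            hN (Submodule.smul_mem_smul (mem_initialIdeal_succ x k) Submodule.mem_top)) hwmem
        rw [hw] at h1
        simpa using add_mem h1 hu'
      · have h1 : v' - y • v ∈ initialIdeal x (k + 1) ^ n • N := by
          refine Submodule.smul_mono_left (Ideal.pow_right_mono (initialIdeal_le_succ x k) n) ?_
          exact pow_succ_smul_top_le_pow_smul hNk n hwmem
        simpa using sub_mem hv' h1

/-- `x_k` is regular on `M / (x_0, …, x_{k-1})ⁿ M`. -/
lemma IsRegularUpTo.mem_pow_smul_top {d k : ℕ} (hreg : IsRegularUpTo x M d) (hk : k < d) (n : ℕ)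
    {m : M} (hm : x k • m ∈ initialIdeal x k ^ n • (⊤ : Submodule A M)) :
    m ∈ initialIdeal x k ^ n • (⊤ : Submodule A M) :=
  mem_pow_smul_top_of_smul_mem (mem_pow_smul_of_smul_mem k (hreg.mono hk.le)
    (initialIdeal x k • ⊤) (x k) le_rfl (hreg k hk)) n m hm

/-- If `J` is generated by an `M`-regular sequence of length `k` and `N ⊇ J M`, then
`Jⁿ M / Jⁿ N` has the length of a direct sum of `(n + k - 1).choose n` copies of `M / N`. -/
lemma relLength_pow_smul (k : ℕ) : IsRegularUpTo x M k → ∀ (N : Submodule A M),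
    initialIdeal x k • (⊤ : Submodule A M) ≤ N → ∀ n,
    relLength (initialIdeal x k ^ n • (⊤ : Submodule A M)) (initialIdeal x k ^ n • N) =
      k.multichoose n * Module.length A (M ⧸ N) := by
  induction k with
  | zero =>
    intro _ N _ n
    cases n with
    | zero => simp [relLength_top_left]
    | succ n =>
      rw [Nat.multichoose_zero_succ, Nat.cast_zero, zero_mul]
      refine relLength_self_left_of_le ?_
      rw [initialIdeal_zero, ← Ideal.zero_eq_bot, zero_pow n.succ_ne_zero, Ideal.zero_eq_bot,
        Submodule.bot_smul]
      exact bot_le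
  | succ k ih =>
    intro hreg N hN n
    have hregk := hreg.mono k.le_succ
    have hNk : initialIdeal x k • (⊤ : Submodule A M) ≤ N :=
      (Submodule.smul_mono_left (initialIdeal_le_succ x k)).trans hN
    induction n with
    | zero => simp [relLength_top_left]
    | succ n ihn =>
      have hxN : ∀ z : M, x k • z ∈ N := fun z =>
        hN (Submodule.smul_mem_smul (mem_initialIdeal_succ x k) Submodule.mem_top)
      -- This controls the overlap of the two summands in the recursion. It makes the two graded
      -- pieces of `B ⊔ x k • W ≤ B ⊔ x k • V ≤ U ⊔ x k • V` have the lengths of `V / W` and `U /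
      -- B`, so the lengths satisfy Pascal's rule.
      have hcol : ∀ m : M, x k • m ∈ initialIdeal x k ^ (n + 1) • (⊤ : Submodule A M) →
          x k • m ∈ initialIdeal x k ^ (n + 1) • N ∧ m ∈ initialIdeal x (k + 1) ^ n • N := by
        intro m hm
        have hm' := hreg.mem_pow_smul_top k.lt_succ_self (n + 1) hm
        constructor
        · exact smul_mem_smul_of_forall_smul_mem hxN hm'
        · refine Submodule.smul_mono_left (Ideal.pow_right_mono (initialIdeal_le_succ x k) n) ?_
          exact pow_succ_smul_top_le_pow_smul hNk n hm'
      set B := initialIdeal x k ^ (n + 1) • N with hB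
      set U := initialIdeal x k ^ (n + 1) • (⊤ : Submodule A M) with hU
      set V := initialIdeal x (k + 1) ^ n • (⊤ : Submodule A M) with hV
      set W := initialIdeal x (k + 1) ^ n • N with hW
      have hBU : B ≤ U := Submodule.smul_mono le_rfl le_top
      have hWV : W ≤ V := Submodule.smul_mono le_rfl le_top
      have hxWV : x k • W ≤ x k • V := Submodule.map_mono hWV
      rw [initialIdeal_succ_pow_smul, initialIdeal_succ_pow_smul, ← hU, ← hB, ← hV, ← hW,
        relLength_eq_add (V := B ⊔ x k • V) (sup_le_sup_left hxWV _) (sup_le_sup_right hBU _),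
        Nat.multichoose_succ_succ, Nat.cast_add, add_mul, ← ih hregk N hNk (n + 1), ← ihn]
      congr 1
      · have h1 : U ⊔ x k • V = U ⊔ (B ⊔ x k • V) := by rw [← sup_assoc, sup_eq_left.mpr hBU]
        rw [h1, relLength_sup_left]
        conv_lhs => rw [← Submodule.map_id U]
        refine relLength_map _ _ _ _ fun u hu => ⟨fun h => ?_, fun h => Submodule.mem_sup_left h⟩
        obtain ⟨b, hb, _, ⟨v, hv, rfl⟩, hbv⟩ := Submodule.mem_sup.mp h
        change b + x k • v = u at hbv
        have h2 : x k • v ∈ U := by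
          rw [← sub_eq_of_eq_add' hbv.symm]
          exact sub_mem hu (hBU hb)
        rw [← hbv]
        exact add_mem hb (hcol v h2).1
      · have h1 : B ⊔ x k • V = x k • V ⊔ (B ⊔ x k • W) := by
          rw [sup_left_comm, sup_eq_left.mpr hxWV]
        rw [h1, relLength_sup_left]
        refine relLength_map (DistribSMul.toLinearMap A M (x k)) V W _ fun v hv =>
          ⟨fun h => ?_, fun h => Submodule.mem_sup_right (Submodule.smul_mem_pointwise_smul _ _ _ h)⟩
        obtain ⟨b, hb, _, ⟨w, hw, rfl⟩, hbw⟩ := Submodule.mem_sup.mp h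
        change b + x k • w = x k • v at hbw
        have h2 : x k • (v - w) ∈ U := by
          rw [smul_sub, ← hbw, add_sub_cancel_right]
          exact hBU hb
        simpa using add_mem (hcol _ h2).2 hw

/-- The Hilbert–Samuel function of an ideal generated by a regular sequence. -/
lemma length_quotient_pow_smul_top {d : ℕ} (hreg : IsRegularUpTo x M d) (n : ℕ) :
    Module.length A (M ⧸ (initialIdeal x d ^ (n + 1) • (⊤ : Submodule A M))) =
      (d + 1).multichoose n *
        Module.length A (M ⧸ (initialIdeal x d • (⊤ : Submodule A M))) := by
  have hstep : ∀ n, relLength ⊤ (initialIdeal x d ^ (n + 1) • (⊤ : Submodule A M)) =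
      relLength ⊤ (initialIdeal x d ^ n • (⊤ : Submodule A M)) +
        d.multichoose n * Module.length A (M ⧸ (initialIdeal x d • (⊤ : Submodule A M))) := by
    intro n
    rw [relLength_eq_add (V := initialIdeal x d ^ n • (⊤ : Submodule A M))
      (Submodule.smul_mono_left (Ideal.pow_le_pow_right n.le_succ)) le_top,
      ← relLength_pow_smul d hreg _ le_rfl n, pow_succ, mul_smul]
  rw [← relLength_top_left]
  induction n with
  | zero => simp [relLength_top_left]
  | succ n ih =>
    rw [hstep, ih, Nat.multichoose_succ_succ, Nat.cast_add, add_mul, add_comm]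

end Filtration

/-! ### Reading off Hilbert coefficients. -/

section HilbertCoeff

namespace LocalCover

lemma IsHilbertPolynomial.hilbertPolynomial_eq {R : Type*} [CommRing R] {I : Ideal R}
    {P : Polynomial ℚ} (h : IsHilbertPolynomial I P) : hilbertPolynomial I = P := by
  have hex : ∃ P, IsHilbertPolynomial I P := ⟨P, h⟩
  rw [hilbertPolynomial, dif_pos hex]
  refine Polynomial.eq_of_infinite_eval_eq _ _ ?_
  obtain ⟨N, hN⟩ := eventually_atTop.mp (hex.choose_spec.and h)
  refine ((Set.Ici_infinite N).image (Nat.cast_injective (R := ℚ)).injOn).mono ?_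
  rintro _ ⟨n, hn, rfl⟩
  obtain ⟨⟨l, hl, hPl⟩, ⟨l', hl', hPl'⟩⟩ := hN n hn
  rw [hl] at hl'
  have : l = l' := by exact_mod_cast hl'
  change _ = _
  rw [hPl, hPl', this]

lemma binomBasis_apply (k : ℕ) : binomBasis k = Polynomial.preHilbertPoly ℚ k 0 :=
  Polynomial.Sequence.basis_eq_self _ _ k

lemma eval_binomBasis (k n : ℕ) : (binomBasis k).eval (n : ℚ) = (n + k).choose k := by
  rw [binomBasis_apply, Polynomial.preHilbertPoly_eq_choose_sub_add ℚ k n.zero_le, Nat.sub_zero]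

lemma natDegree_binomBasis (k : ℕ) : (binomBasis k).natDegree = k := by
  rw [binomBasis_apply, Polynomial.natDegree_preHilbertPoly]

/-- The polynomial `e (X + d).choose d + c ∑_{i = 1}^{d - 1} (X + i).choose i`. -/
noncomputable def coverPolynomial (d : ℕ) (e c : ℚ) : Polynomial ℚ :=
  e • binomBasis d + c • (∑ i ∈ Finset.range d, binomBasis i - binomBasis 0)

lemma multichoose_add_one (d n : ℕ) : (d + 1).multichoose n = (n + d).choose d := by
  rw [Nat.multichoose_eq, add_right_comm, Nat.add_sub_cancel, add_comm d n, Nat.choose_symm_add]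

lemma multichoose_eq_sum (d n : ℕ) :
    d.multichoose (n + 1) = ∑ i ∈ Finset.range d, (n + i).choose i := by
  induction d with
  | zero => simp
  | succ d ih => rw [Nat.multichoose_succ_succ, Finset.sum_range_succ, ih, multichoose_add_one]

/-- The trailing `-c` accounts for `λ(S/R)` on the left of the length identity; it cancels the `i =
0` term of the sum. -/
lemma eval_coverPolynomial (d : ℕ) (e c : ℚ) (n : ℕ) :
    (coverPolynomial d e c).eval (n : ℚ) =
      (d + 1).multichoose n * e + d.multichoose (n + 1) * c - c := by
  rw [coverPolynomial, multichoose_eq_sum, multichoose_add_one]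
  simp only [Polynomial.eval_add, Polynomial.eval_smul, Polynomial.eval_sub,
    Polynomial.eval_finsetSum, eval_binomBasis, smul_eq_mul, Nat.cast_sum]
  simp
  ring

lemma natDegree_coverPolynomial {d : ℕ} (hd : 1 ≤ d) {e : ℚ} (he : e ≠ 0) (c : ℚ) :
    (coverPolynomial d e c).natDegree = d := by
  have hb : ∀ i, i < d → binomBasis i ∈ Polynomial.degreeLT ℚ d := fun i hi => by
    rw [Polynomial.mem_degreeLT]
    refine Polynomial.degree_le_natDegree.trans_lt ?_
    rw [natDegree_binomBasis]
    exact_mod_cast hi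
  have hlow : c • (∑ i ∈ Finset.range d, binomBasis i - binomBasis 0) ∈
      Polynomial.degreeLT ℚ d :=
    Submodule.smul_mem _ _ (Submodule.sub_mem _
      (Submodule.sum_mem _ fun i hi => hb i (Finset.mem_range.mp hi)) (hb 0 hd))
  have hdeg : (e • binomBasis d).degree = d := by
    rw [Polynomial.degree_smul_of_smul_regular _ (IsSMulRegular.of_ne_zero he),
      Polynomial.degree_eq_natDegree (binomBasis.ne_zero d), natDegree_binomBasis]
  refine Polynomial.natDegree_eq_of_degree_eq_some ?_
  rw [coverPolynomial, Polynomial.degree_add_eq_left_of_degree_lt, hdeg]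
  rw [hdeg]
  exact Polynomial.mem_degreeLT.mp hlow

lemma binomBasis_repr_coverPolynomial (d : ℕ) (e c : ℚ) (k : ℕ) :
    binomBasis.repr (coverPolynomial d e c) k =
      (if k = d then e else 0) + c * ((if k < d then 1 else 0) - (if k = 0 then 1 else 0)) := by
  simp [coverPolynomial, Finsupp.single_apply, eq_comm]

lemma hilbertCoeff_zero_coverPolynomial {d : ℕ} (hd : 1 ≤ d) {e : ℚ} (he : e ≠ 0) (c : ℚ) :
    hilbertCoeff (coverPolynomial d e c) 0 = e := by
  rw [hilbertCoeff, natDegree_coverPolynomial hd he, binomBasis_repr_coverPolynomial]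
  simp [Nat.one_le_iff_ne_zero.mp hd]

/-- For `d = 1` the index `d - 1` is `0`, whose basis vector has been subtracted; this is why `2 ≤
d` is required. -/
lemma hilbertCoeff_one_coverPolynomial {d : ℕ} (hd : 2 ≤ d) {e : ℚ} (he : e ≠ 0) (c : ℚ) :
    hilbertCoeff (coverPolynomial d e c) 1 = -c := by
  rw [hilbertCoeff, natDegree_coverPolynomial (by omega) he, binomBasis_repr_coverPolynomial,
    if_neg (by omega), if_pos (by omega), if_neg (by omega)]
  simp

end LocalCover

end HilbertCoeff

/-! ### Systems of parameters of `R` acting on `S`. -/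

section Parameters

lemma isRegularUpTo_iff_isWeaklyRegular {A M : Type*} [CommRing A] [AddCommGroup M] [Module A M]
    {x : ℕ → A} {d : ℕ} : IsRegularUpTo x M d ↔ IsWeaklyRegular M ((List.range d).map x) := by
  have hI : ∀ i, Ideal.ofList ((List.range i).map x) = initialIdeal x i := fun i => by
    rw [initialIdeal, Ideal.ofList]
    congr 1
    ext r
    simp
  rw [isWeaklyRegular_iff]
  simp only [List.length_map, List.length_range, ← List.map_take, List.take_range,
    List.getElem_map, List.getElem_range, isSMulRegular_quotient_iff_mem_of_smul_mem]
  refine forall₂_congr fun i hi => ?_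
  rw [min_eq_left hi.le, hI]

/-- A system of parameters, extended by zero to a sequence. -/
lemma exists_initialIdeal_eq {R : Type*} [CommRing R] {k : ℕ} (x : Fin k → R) :
    ∃ x' : ℕ → R, (∀ i : Fin k, x' i = x i) ∧ initialIdeal x' k = Ideal.span (Set.range x) ∧
      ∀ i : Fin k, initialIdeal x' i = Ideal.span (x '' Set.Iio i) := by
  have h0 : ∀ i : Fin k, (fun i => if h : i < k then x ⟨i, h⟩ else 0) (i : ℕ) = x i :=
    fun i => dif_pos i.2
  refine ⟨fun i => if h : i < k then x ⟨i, h⟩ else 0, h0, ?_, fun i => ?_⟩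
  · rw [initialIdeal]
    congr 1
    ext r
    constructor
    · rintro ⟨j, hj, rfl⟩
      exact ⟨⟨j, hj⟩, (h0 ⟨j, hj⟩).symm⟩
    · rintro ⟨j, rfl⟩
      exact ⟨j, j.2, h0 j⟩
  · rw [initialIdeal]
    congr 1
    ext r
    constructor
    · rintro ⟨j, hj, rfl⟩
      exact ⟨⟨j, lt_trans hj i.2⟩, hj, (h0 ⟨j, lt_trans hj i.2⟩).symm⟩
    · rintro ⟨j, hj, rfl⟩
      exact ⟨j, hj, h0 j⟩

/-- Every prime over `J` contains the maximal ideal `J.radical`, so `R ⧸ J` is Noetherian of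
dimension zero, hence Artinian. -/
lemma length_quotient_ne_top_of_radical_isMaximal {R : Type*} [CommRing R]
    [IsNoetherianRing R] {J : Ideal R} (hJ : J.radical.IsMaximal) :
    Module.length R (R ⧸ J) ≠ ⊤ := by
  have : Ring.KrullDimLE 0 (R ⧸ J) := .mk₀ fun Q hQ => by
    have h1 : J.radical ≤ Q.comap (Ideal.Quotient.mk J) := by
      rw [Ideal.IsPrime.radical_le_iff inferInstance]
      intro r hr
      rw [Ideal.mem_comap, Ideal.Quotient.eq_zero_iff_mem.mpr hr]
      exact zero_mem _
    have h2 := hJ.eq_of_le (Ideal.IsPrime.ne_top inferInstance) h1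
    have h3 : (Q.comap (Ideal.Quotient.mk J)).IsMaximal := h2 ▸ hJ
    rw [← Ideal.map_comap_of_surjective _ Ideal.Quotient.mk_surjective Q]
    exact (Ideal.map_eq_top_or_isMaximal_of_surjective _ Ideal.Quotient.mk_surjective h3).resolve_left
      fun h => hQ.ne_top (by rwa [Ideal.map_comap_of_surjective _ Ideal.Quotient.mk_surjective] at h)
  have : IsArtinianRing (R ⧸ J) := isArtinianRing_iff_krullDimLE_zero.mpr this
  rw [Module.length_eq_of_surjective (R := R ⧸ J) (S := R) Ideal.Quotient.mk_surjective]
  exact Module.length_ne_top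

variable {R S : Type*} [CommRing R] [IsLocalRing R] [IsNoetherianRing R] [CommRing S]
  [IsLocalRing S] [Algebra R S] [Module.Finite R S]

/-- A system of parameters of `R` is regular on every finite local Cohen–Macaulay extension. -/
lemma isRegularUpTo_of_isCohenMacaulayLocal (hinj : Function.Injective (algebraMap R S))
    (hCM : IsCohenMacaulayLocal S) {d : ℕ} (hdim : ringKrullDim R = d) {x : ℕ → R}
    (hx : (initialIdeal x d).radical = maximalIdeal R) : IsRegularUpTo x S d := by
  have hS : IsNoetherianRing S := IsNoetherianRing.of_finite R S
  obtain ⟨rs, hrs, hreg, hlen⟩ := hCM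
  have hd : d ≤ rs.length := by
    have := ringKrullDim_le_of_isIntegral hinj
    rw [hdim, hlen] at this
    exact_mod_cast this
  have hcomap : (maximalIdeal S).comap (algebraMap R S) = maximalIdeal R :=
    eq_maximalIdeal (Ideal.isMaximal_comap_of_isIntegral_of_isMaximal (maximalIdeal S))
  have hofList : Ideal.ofList (((List.range d).map x).map (algebraMap R S)) =
      (initialIdeal x d).map (algebraMap R S) := by
    rw [← Ideal.map_ofList, initialIdeal, Ideal.ofList]
    congr 2
    ext r
    simp
  rw [isRegularUpTo_iff_isWeaklyRegular, ← isWeaklyRegular_map_algebraMap_iff S S]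
  refine isWeaklyRegular_of_maximalIdeal_le_radical _ hrs hreg.toIsWeaklyRegular (by simpa)
    ?_ ?_
  · simp only [List.mem_map, List.mem_range]
    rintro _ ⟨_, ⟨i, hi, rfl⟩, rfl⟩
    rw [← Ideal.mem_comap, hcomap, ← hx]
    exact Ideal.le_radical (Ideal.subset_span ⟨i, hi, rfl⟩)
  -- A prime of `S` over `JS` contracts to the maximal ideal of `R`, hence is maximal by
  -- integrality.
  · rw [hofList, Ideal.radical_eq_sInf]
    refine le_sInf fun Q ⟨hQ, hQp⟩ => ?_
    have h1 : initialIdeal x d ≤ Q.comap (algebraMap R S) :=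
      Ideal.map_le_iff_le_comap.mp (le_sup_right.trans hQ)
    have h2 : maximalIdeal R ≤ Q.comap (algebraMap R S) := by
      rw [← hx]
      exact (Ideal.IsPrime.radical_le_iff inferInstance).mpr h1
    have h3 : (Q.comap (algebraMap R S)).IsMaximal := by
      rw [← (maximalIdeal.isMaximal R).eq_of_le (Ideal.IsPrime.ne_top inferInstance) h2]
      exact maximalIdeal.isMaximal R
    have h4 : Q.IsMaximal := Ideal.isMaximal_of_isIntegral_of_isMaximal_comap Q h3
    exact (eq_maximalIdeal h4).ge

end Parameters

/-! ### The extension `R ⊆ S`: generators, lengths and the main theorem. -/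

section Cover

variable {R S : Type*} [CommRing R] [CommRing S] [Algebra R S]

lemma maxIdealSubset_iff_smul_mem [IsLocalRing R] :
    MaxIdealSubset R S ↔
      ∀ r ∈ maximalIdeal R, ∀ s : S, r • s ∈ LinearMap.range (Algebra.linearMap R S) := by
  constructor
  · intro h r hr s
    obtain ⟨r', hr'⟩ := h (Ideal.mul_mem_right s _ (Ideal.mem_map_of_mem (algebraMap R S) hr))
    exact ⟨r', by rw [Algebra.linearMap_apply, hr', Algebra.smul_def]⟩
  · intro h z hz
    -- Quantifying over `s` makes the property stable under the `S`-multiples in the span.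
    suffices ∀ s : S, s * z ∈ LinearMap.range (Algebra.linearMap R S) by
      obtain ⟨r, hr⟩ := this 1
      exact ⟨r, by rw [← one_mul z, ← hr, Algebra.linearMap_apply]⟩
    refine Submodule.span_induction (p := fun z _ => ∀ s : S, s * z ∈ _) ?_ ?_ ?_ ?_ hz
    · rintro _ ⟨r, hr, rfl⟩ s
      rw [mul_comm, ← Algebra.smul_def]
      exact h r hr s
    · intro s
      rw [mul_zero]
      exact zero_mem _
    · intro a b _ _ ha hb s
      rw [mul_add]
      exact add_mem (ha s) (hb s)
    · intro a b _ hb s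
      rw [smul_eq_mul, ← mul_assoc]
      exact hb (s * a)

/-- By Nakayama `μ(M) = λ(M/𝔪M)`, which differs from the finite length `λ(M)` by `λ(𝔪M)`. -/
lemma minGen_eq_len_iff [IsLocalRing R] {M : Type*} [AddCommGroup M] [Module R M]
    (hfin : Module.length R M ≠ ⊤) :
    minGen R M = len R M ↔ ∀ r ∈ maximalIdeal R, ∀ z : M, r • z = 0 := by
  have : IsFiniteLength R M := Module.length_ne_top_iff.mp hfin
  obtain ⟨_, _⟩ := isFiniteLength_iff_isNoetherian_isArtinian.mp this
  let X := (⊤ : Submodule R M)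
  have h1 : minGen R M = (Module.length R (X ⧸ maximalIdeal R • (⊤ : Submodule R X))).toNat := by
    let _ : Field (R ⧸ maximalIdeal R) := Ideal.Quotient.field _
    rw [minGen, spanFinrank_eq_finrank_quotient _ (IsNoetherian.noetherian _),
      Module.length_eq_of_surjective (R := R ⧸ maximalIdeal R) (S := R)
        Ideal.Quotient.mk_surjective, Module.length_eq_finrank]
    rfl
  have h2 : Module.length R X = Module.length R (maximalIdeal R • (⊤ : Submodule R X) :) +
      Module.length R (X ⧸ maximalIdeal R • (⊤ : Submodule R X)) :=
    Module.length_eq_add_of_exact _ _ (Submodule.subtype_injective _) (Submodule.mkQ_surjective _)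
      (LinearMap.exact_subtype_mkQ _)
  have h3 : minGen R M = len R M ↔ maximalIdeal R • (⊤ : Submodule R X) = ⊥ := by
    rw [Module.length_top] at h2
    rw [h1, len, h2, ← Submodule.subsingleton_iff_eq_bot, ← Module.length_eq_zero_iff (R := R)]
    rw [h2] at hfin
    obtain ⟨ha, hb⟩ := WithTop.add_ne_top.mp hfin
    lift Module.length R (maximalIdeal R • (⊤ : Submodule R X) :) to ℕ using ha with a
    lift Module.length R (X ⧸ maximalIdeal R • (⊤ : Submodule R X)) to ℕ using hb with b
    rw [← Nat.cast_add, ENat.toNat_natCast, ENat.toNat_natCast]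
    norm_cast
    omega
  rw [h3, ← le_bot_iff, Submodule.smul_le]
  constructor
  · intro h r hr z
    exact congrArg Subtype.val ((Submodule.mem_bot R).mp
      (h r hr (⟨z, Submodule.mem_top⟩ : X) Submodule.mem_top))
  · rintro h r hr ⟨z, hz⟩ -
    exact (Submodule.mem_bot R).mpr (Subtype.ext (h r hr z))

lemma minGen_eq_len_iff_maxIdealSubset [IsLocalRing R]
    (hlen : Module.length R (CoverQuotient R S) ≠ ⊤) :
    minGen R (CoverQuotient R S) = len R (CoverQuotient R S) ↔ MaxIdealSubset R S := by
  rw [minGen_eq_len_iff hlen, maxIdealSubset_iff_smul_mem]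
  refine forall₂_congr fun r _ => ?_
  rw [(Submodule.mkQ_surjective _).forall]
  refine forall_congr' fun s => ?_
  rw [← map_smul, Submodule.mkQ_apply, Submodule.Quotient.mk_eq_zero]

lemma smul_range_linearMap (I : Ideal R) :
    I • LinearMap.range (Algebra.linearMap R S) = Submodule.map (Algebra.linearMap R S) I := by
  rw [LinearMap.range_eq_map, ← Submodule.map_smul'', smul_eq_mul, Ideal.mul_top]

lemma algebraMap_mem_smul_range_iff (hinj : Function.Injective (algebraMap R S)) {I : Ideal R}
    {r : R} : algebraMap R S r ∈ I • LinearMap.range (Algebra.linearMap R S) ↔ r ∈ I := by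
  rw [smul_range_linearMap]
  exact ⟨fun ⟨_, hr', h⟩ => hinj h ▸ hr', fun h => ⟨r, h, rfl⟩⟩

/-- The Hilbert–Samuel function of a parameter ideal `J` of `R` when `J S ⊆ R`. -/
lemma length_coverQuotient_add_length_quotient_pow (hinj : Function.Injective (algebraMap R S))
    {d : ℕ} {x : ℕ → R} (hreg : IsRegularUpTo x S d)
    (hJ : initialIdeal x d • (⊤ : Submodule R S) ≤ LinearMap.range (Algebra.linearMap R S))
    (n : ℕ) :
    Module.length R (CoverQuotient R S) + Module.length R (R ⧸ initialIdeal x d ^ (n + 1)) =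
      (d + 1).multichoose n *
          Module.length R (S ⧸ (initialIdeal x d • (⊤ : Submodule R S))) +
        d.multichoose (n + 1) * Module.length R (CoverQuotient R S) := by
  set N := LinearMap.range (Algebra.linearMap R S) with hN
  have h1 : relLength N (initialIdeal x d ^ (n + 1) • N) =
      Module.length R (R ⧸ initialIdeal x d ^ (n + 1)) := by
    rw [← relLength_top_left]
    conv_lhs => rw [hN, LinearMap.range_eq_map]
    refine relLength_map _ _ _ _ fun r _ => ?_
    rw [← LinearMap.range_eq_map]
    exact algebraMap_mem_smul_range_iff hinj
  -- Both sides become `λ(S/Jⁿ⁺¹R)`, split along `R` on the left and along `Jⁿ⁺¹S` on the right.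
  rw [← length_quotient_pow_smul_top hreg, ← relLength_pow_smul d hreg N hJ (n + 1), ← h1,
    ← relLength_top_left, ← relLength_top_left,
    ← relLength_eq_add Submodule.smul_le_right le_top,
    ← relLength_eq_add (Submodule.smul_mono le_rfl le_top) le_top]

/-- The Hilbert polynomial of a parameter ideal `J` of `R` when `J S ⊆ R`, together with the length
of `R / J`. -/
lemma exists_isHilbertPolynomial_coverPolynomial [IsLocalRing R] [IsNoetherianRing R]
    [Module.Finite R S] [Nontrivial S] (hinj : Function.Injective (algebraMap R S))
    (hlen : Module.length R (CoverQuotient R S) ≠ ⊤) {d : ℕ} {x : ℕ → R}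
    (hreg : IsRegularUpTo x S d) (hrad : (initialIdeal x d).radical = maximalIdeal R)
    (hJ : initialIdeal x d • (⊤ : Submodule R S) ≤ LinearMap.range (Algebra.linearMap R S)) :
    ∃ e : ℕ, e ≠ 0 ∧
      IsHilbertPolynomial (initialIdeal x d) (coverPolynomial d e (len R (CoverQuotient R S))) ∧
      len R (CoverQuotient R S) + len R (R ⧸ initialIdeal x d) =
        e + d * len R (CoverQuotient R S) := by
  have hfun := length_coverQuotient_add_length_quotient_pow hinj hreg hJ
  have h0 := hfun 0
  have hfin : Module.length R (R ⧸ initialIdeal x d) ≠ ⊤ :=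
    length_quotient_ne_top_of_radical_isMaximal (by rw [hrad]; exact maximalIdeal.isMaximal R)
  rw [zero_add, pow_one, Nat.multichoose_zero_right, Nat.multichoose_one_right, Nat.cast_one,
    one_mul] at h0
  -- Nakayama: `JS ≠ S`. Nonvanishing of `e` is what gives the Hilbert polynomial degree `d`.
  have hne : Module.length R (S ⧸ (initialIdeal x d • (⊤ : Submodule R S))) ≠ 0 := by
    rw [Ne, Module.length_eq_zero_iff, Submodule.Quotient.subsingleton_iff]
    refine Ne.symm (Submodule.top_ne_ideal_smul_of_le_jacobson_annihilator ?_)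
    refine le_trans ?_ (maximalIdeal_le_jacobson _)
    rw [← hrad]
    exact Ideal.le_radical
  have hefin : Module.length R (S ⧸ (initialIdeal x d • (⊤ : Submodule R S))) ≠ ⊤ := by
    intro h
    rw [h, top_add] at h0
    exact WithTop.add_ne_top.mpr ⟨hlen, hfin⟩ h0
  rw [len, len]
  lift Module.length R (S ⧸ (initialIdeal x d • (⊤ : Submodule R S))) to ℕ using hefin with e he
  lift Module.length R (CoverQuotient R S) to ℕ using hlen with c hc
  lift Module.length R (R ⧸ initialIdeal x d) to ℕ using hfin with l hl
  refine ⟨e, by exact_mod_cast hne, Eventually.of_forall fun n => ?_, ?_⟩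
  · have hn := hfun n
    have hnfin : Module.length R (R ⧸ initialIdeal x d ^ (n + 1)) ≠ ⊤ := fun h => by
      rw [h, add_top] at hn
      exact absurd hn.symm (by exact_mod_cast ENat.natCast_ne_top _)
    lift Module.length R (R ⧸ initialIdeal x d ^ (n + 1)) to ℕ using hnfin with m hm
    refine ⟨m, rfl, ?_⟩
    have hn' : c + m = (d + 1).multichoose n * e + d.multichoose (n + 1) * c := by
      exact_mod_cast hn
    have hq : (c + m : ℚ) = (d + 1).multichoose n * e + d.multichoose (n + 1) * c := by
      exact_mod_cast hn'
    rw [eval_coverPolynomial, ENat.toNat_natCast, ← hq, add_sub_cancel_left]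
  · rw [ENat.toNat_natCast, ENat.toNat_natCast]
    exact_mod_cast h0

end Cover

theorem mainTheorem7 {R : Type*} {S : Type*} [CommRing R] [IsLocalRing R] [IsNoetherianRing R]
    [CommRing S] [IsLocalRing S] [Algebra R S] [Module.Finite R S]
    (hinj : Function.Injective (algebraMap R S))
    (hlen : Module.length R (CoverQuotient R S) ≠ ⊤)
    (d : ℕ) (hdim : ringKrullDim R = d) (hd : 1 ≤ d)
    (hCM : IsCohenMacaulayLocal S) :
    (minGen R (CoverQuotient R S) = len R (CoverQuotient R S) ↔ MaxIdealSubset R S) ∧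
    (minGen R (CoverQuotient R S) = len R (CoverQuotient R S) →
      (∀ J : Ideal R, IsParameterIdeal R J →
        (IsHilbertPolynomial J (hilbertPolynomial J) ∧ (hilbertPolynomial J).natDegree = d) ∧
        (2 ≤ d → e1 J = -(minGen R (CoverQuotient R S) : ℚ) ∧
          e1 J = -(len R (CoverQuotient R S) : ℚ)) ∧
        (Module.length R (R ⧸ J) ≠ ⊤ ∧
          (len R (R ⧸ J) : ℚ) - e0 J = ((d : ℚ) - 1) * (len R (CoverQuotient R S) : ℚ))) ∧
      IsBuchsbaum R) := by
  refine ⟨minGen_eq_len_iff_maxIdealSubset hlen, fun hgen => ?_⟩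
  have hsub := maxIdealSubset_iff_smul_mem.mp ((minGen_eq_len_iff_maxIdealSubset hlen).mp hgen)
  constructor
  · rintro J ⟨k, y, ⟨hk, hrad⟩, rfl⟩
    obtain rfl : k = d := by rw [hdim] at hk; exact_mod_cast hk.symm
    obtain ⟨x, -, hx, -⟩ := exists_initialIdeal_eq y
    rw [← hx] at hrad ⊢
    have hreg := isRegularUpTo_of_isCohenMacaulayLocal hinj hCM hdim hrad
    have hJm : initialIdeal x k ≤ maximalIdeal R := hrad ▸ Ideal.le_radical
    have hJ : initialIdeal x k • (⊤ : Submodule R S) ≤ LinearMap.range (Algebra.linearMap R S) :=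
      Submodule.smul_le.mpr fun r hr s _ => hsub r (hJm hr) s
    obtain ⟨e, he, hP, hl⟩ := exists_isHilbertPolynomial_coverPolynomial hinj hlen hreg hrad hJ
    have heq : (e : ℚ) ≠ 0 := Nat.cast_ne_zero.mpr he
    rw [e0, e1, hP.hilbertPolynomial_eq, hilbertCoeff_zero_coverPolynomial hd heq, hgen]
    refine ⟨⟨hP, natDegree_coverPolynomial hd heq _⟩, fun h2 => ?_, ?_, ?_⟩
    · rw [hilbertCoeff_one_coverPolynomial h2 heq]
      exact ⟨rfl, rfl⟩
    · exact length_quotient_ne_top_of_radical_isMaximal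
        (by rw [hrad]; exact maximalIdeal.isMaximal R)
    · have hl' : (len R (CoverQuotient R S) + len R (R ⧸ initialIdeal x k) : ℚ) =
          e + k * len R (CoverQuotient R S) := by exact_mod_cast hl
      linear_combination hl'
  · intro k y ⟨hk, hrad⟩ i r
    obtain ⟨x, hxy, hx, hxi⟩ := exists_initialIdeal_eq y
    rw [← hx] at hrad
    have hreg := isRegularUpTo_of_isCohenMacaulayLocal hinj hCM hk hrad
    have hmul : ∀ a b : R, algebraMap R S (a * b) = a • algebraMap R S b := fun a b => by
      rw [map_mul, Algebra.smul_def]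
    rw [← hxi, ← hxy]
    constructor
    · intro h a ha
      -- The colon is trivial over `S`; the obstruction over `R` is removed by `a`, which maps `S`
      -- into `R`.
      have h1 : algebraMap R S r ∈ initialIdeal x i • (⊤ : Submodule R S) := by
        refine hreg i i.2 _ ?_
        rw [← hmul]
        exact Submodule.smul_mono le_rfl le_top ((algebraMap_mem_smul_range_iff hinj).mpr h)
      have h2 := smul_mem_smul_of_forall_smul_mem (hsub a ha) h1
      rwa [← hmul, algebraMap_mem_smul_range_iff hinj] at h2
    · intro h
      refine h _ ?_
      rw [← hrad]
      exact Ideal.le_radical (Ideal.subset_span ⟨i, i.2, rfl⟩)
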